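/- Let $s>0$ and let $\mathcal P=\mathbb R[S_1,S_2,S_3]/(S_1^2+S_2^2+S_3^2-s^2)$ be the Poisson algebra of polynomials on the sphere of radius $s$, with the bracket \[\{f,g\}=\sum_{i,j,k=1}^3\epsilon_{ijk}\,S_i\,\frac{\partial f}{\partial S_j}\,\frac{\partial g}{\partial S_k}\] computed on polynomial representatives. The degree of an element of $\mathcal P$ is the minimum of the degrees of its polynomial representatives. By a Poisson subalgebra of $\mathcal P$ we mean a real linear subspace closed under $\{\cdot,\cdot\}$ (not necessarily under multiplication). Let $\mathcal P^1$ be the Poisson subalgebra of elements of degree at most $1$, let $\mathcal O$ be the Poisson subalgebra of odd polynomials (classes of polynomials all of whose terms have odd degree), and let $\tilde{\mathcal O}=\mathcal O\oplus\mathbb R$ be the Poisson subalgebra obtained by adding the constants. Then $\mathcal P^1$ is a maximal Poisson subalgebra of $\tilde{\mathcal O}$: one has $\mathcal P^1\subsetneq\tilde{\mathcal O}$, and every Poisson subalgebra $\mathcal R$ with $\mathcal P^1\subseteq\mathcal R\subseteq\tilde{\mathcal O}$ equals $\mathcal P^1$ or $\tilde{\mathcal O}$. Moreover, for every $r\in\mathcal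 O$ of degree greater than $1$, the smallest Poisson subalgebra of $\mathcal P$ containing $\mathcal P^1$ and $r$ is $\tilde{\mathcal O}$. -/

import Mathlib

namespace SpinSphere

open MvPolynomial

noncomputable section

/-! ### The bracket on polynomials in three variables -/

/-- The bracket `{f, g} = ∑ ε_{ijk} S_i (∂f/∂S_j) (∂g/∂S_k)` on `ℝ[S₁, S₂, S₃]`, with the sum over
the six nonzero `ε_{ijk}` written out; the variables are indexed by `0, 1, 2`. -/
def polyBracket (f g : MvPolynomial (Fin 3) ℝ) : MvPolynomial (Fin 3) ℝ :=
  X 0 * (pderiv 1 f * pderiv 2 g - pderiv 2 f * pderiv 1 g) +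
  X 1 * (pderiv 2 f * pderiv 0 g - pderiv 0 f * pderiv 2 g) +
  X 2 * (pderiv 0 f * pderiv 1 g - pderiv 1 f * pderiv 0 g)

theorem pderiv_pderiv_comm (i j : Fin 3) (f : MvPolynomial (Fin 3) ℝ) :
    pderiv i (pderiv j f) = pderiv j (pderiv i f) := by
  let D : Fin 3 → Derivation ℝ (MvPolynomial (Fin 3) ℝ) (MvPolynomial (Fin 3) ℝ) := pderiv
  have h : ⁅D i, D j⁆ = 0 := by
    apply MvPolynomial.derivation_ext
    intro k
    rw [Derivation.commutator_apply]
    simp only [D, pderiv_X, Pi.single_apply]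
    split_ifs <;> simp
  have h2 : ⁅D i, D j⁆ f = 0 := by rw [h]; rfl
  rw [Derivation.commutator_apply] at h2
  exact sub_eq_zero.mp h2

theorem polyBracket_add_left (f g h : MvPolynomial (Fin 3) ℝ) :
    polyBracket (f + g) h = polyBracket f h + polyBracket g h := by
  simp only [polyBracket, map_add]; ring

theorem polyBracket_antisymm (f g : MvPolynomial (Fin 3) ℝ) :
    polyBracket f g = - polyBracket g f := by
  simp only [polyBracket]; ring

theorem polyBracket_add_right (f g h : MvPolynomial (Fin 3) ℝ) :
    polyBracket f (g + h) = polyBracket f g + polyBracket f h := by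
  simp only [polyBracket, map_add]; ring

theorem polyBracket_smul_right (c : ℝ) (f g : MvPolynomial (Fin 3) ℝ) :
    polyBracket f (c • g) = c • polyBracket f g := by
  simp only [polyBracket, smul_eq_C_mul, pderiv_C_mul]; ring

theorem polyBracket_jacobi (f g h : MvPolynomial (Fin 3) ℝ) :
    polyBracket f (polyBracket g h) =
      polyBracket (polyBracket f g) h + polyBracket g (polyBracket f h) := by
  have e10 := pderiv_pderiv_comm 1 0
  have e20 := pderiv_pderiv_comm 2 0
  have e21 := pderiv_pderiv_comm 2 1
  simp [polyBracket, pderiv_X, e10, e20, e21]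
  ring

/-! ### The Poisson algebra of polynomials on the sphere -/

/-- The ideal of `ℝ[S₁, S₂, S₃]` generated by `S₁² + S₂² + S₃² - s²`. -/
def sphereIdeal (s : ℝ) : Ideal (MvPolynomial (Fin 3) ℝ) :=
  Ideal.span {X 0 ^ 2 + X 1 ^ 2 + X 2 ^ 2 - C (s ^ 2)}

/-- The algebra `𝒫` of polynomials in `S₁, S₂, S₃` modulo the relation `S₁² + S₂² + S₃² = s²`. -/
def Poly (s : ℝ) : Type := MvPolynomial (Fin 3) ℝ ⧸ sphereIdeal s

instance (s : ℝ) : CommRing (Poly s) := inferInstanceAs (CommRing (_ ⧸ sphereIdeal s))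

instance (s : ℝ) : Algebra ℝ (Poly s) := inferInstanceAs (Algebra ℝ (_ ⧸ sphereIdeal s))

/-- The class in `𝒫` of a polynomial in `S₁, S₂, S₃`. -/
def mk (s : ℝ) : MvPolynomial (Fin 3) ℝ →ₐ[ℝ] Poly s := Ideal.Quotient.mkₐ ℝ (sphereIdeal s)

theorem mk_surjective (s : ℝ) : Function.Surjective (mk s) :=
  Ideal.Quotient.mkₐ_surjective ℝ (sphereIdeal s)

theorem mk_eq_mk_iff {s : ℝ} {f g : MvPolynomial (Fin 3) ℝ} :
    mk s f = mk s g ↔ f - g ∈ sphereIdeal s :=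
  Ideal.Quotient.eq

theorem polyBracket_mem_sphereIdeal {s : ℝ} (f : MvPolynomial (Fin 3) ℝ)
    {g : MvPolynomial (Fin 3) ℝ} (hg : g ∈ sphereIdeal s) :
    polyBracket f g ∈ sphereIdeal s := by
  obtain ⟨a, rfl⟩ := Ideal.mem_span_singleton'.mp hg
  have : polyBracket f (a * (X 0 ^ 2 + X 1 ^ 2 + X 2 ^ 2 - C (s ^ 2))) =
      polyBracket f a * (X 0 ^ 2 + X 1 ^ 2 + X 2 ^ 2 - C (s ^ 2)) := by
    simp [polyBracket, pow_two, pderiv_X]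
    ring
  rw [this]
  exact Ideal.mul_mem_left _ _ (Ideal.subset_span rfl)

theorem mk_polyBracket_congr {s : ℝ} {f f' g g' : MvPolynomial (Fin 3) ℝ}
    (hf : mk s f = mk s f') (hg : mk s g = mk s g') :
    mk s (polyBracket f g) = mk s (polyBracket f' g') := by
  have h1 : mk s (polyBracket f g) = mk s (polyBracket f g') := by
    rw [mk_eq_mk_iff] at hg ⊢
    have := polyBracket_mem_sphereIdeal f hg
    rwa [sub_eq_add_neg, polyBracket_add_right, ← neg_one_smul ℝ g', polyBracket_smul_right,
      neg_one_smul, ← sub_eq_add_neg] at this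
  have h2 : mk s (polyBracket g' f) = mk s (polyBracket g' f') := by
    rw [mk_eq_mk_iff] at hf ⊢
    have := polyBracket_mem_sphereIdeal g' hf
    rwa [sub_eq_add_neg, polyBracket_add_right, ← neg_one_smul ℝ f', polyBracket_smul_right,
      neg_one_smul, ← sub_eq_add_neg] at this
  rw [h1, polyBracket_antisymm f, polyBracket_antisymm f', map_neg, map_neg, h2]

/-- The Poisson bracket of `𝒫`, computed on polynomial representatives. -/
instance (s : ℝ) : Bracket (Poly s) (Poly s) where
  bracket p q := Quotient.liftOn₂ p q (fun f g => mk s (polyBracket f g))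
    (fun _ _ _ _ hf hg =>
      mk_polyBracket_congr (Quotient.sound hf : mk s _ = mk s _) (Quotient.sound hg))

theorem mk_lie_mk (s : ℝ) (f g : MvPolynomial (Fin 3) ℝ) :
    ⁅mk s f, mk s g⁆ = mk s (polyBracket f g) := rfl

instance (s : ℝ) : LieRing (Poly s) where
  add_lie p q r := by
    obtain ⟨f, rfl⟩ := mk_surjective s p
    obtain ⟨g, rfl⟩ := mk_surjective s q
    obtain ⟨h, rfl⟩ := mk_surjective s r
    rw [← map_add, mk_lie_mk, mk_lie_mk, mk_lie_mk, polyBracket_add_left, map_add]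
  lie_add p q r := by
    obtain ⟨f, rfl⟩ := mk_surjective s p
    obtain ⟨g, rfl⟩ := mk_surjective s q
    obtain ⟨h, rfl⟩ := mk_surjective s r
    rw [← map_add, mk_lie_mk, mk_lie_mk, mk_lie_mk, polyBracket_add_right, map_add]
  lie_self p := by
    obtain ⟨f, rfl⟩ := mk_surjective s p
    have : polyBracket f f = 0 := by simp only [polyBracket]; ring
    rw [mk_lie_mk, this, map_zero]
  leibniz_lie p q r := by
    obtain ⟨f, rfl⟩ := mk_surjective s p
    obtain ⟨g, rfl⟩ := mk_surjective s q
    obtain ⟨h, rfl⟩ := mk_surjective s r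
    simp only [mk_lie_mk]
    rw [← map_add, polyBracket_jacobi]

instance (s : ℝ) : LieAlgebra ℝ (Poly s) where
  lie_smul c p q := by
    obtain ⟨f, rfl⟩ := mk_surjective s p
    obtain ⟨g, rfl⟩ := mk_surjective s q
    rw [← map_smul, mk_lie_mk, mk_lie_mk, polyBracket_smul_right, map_smul]

/-- The degree of an element of `𝒫`: the minimum of the degrees of its representatives. -/
def degree {s : ℝ} (p : Poly s) : ℕ :=
  sInf {n | ∃ f : MvPolynomial (Fin 3) ℝ, mk s f = p ∧ f.totalDegree = n}

/-! ### The subalgebras -/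

theorem polyBracket_mem_restrictSupport {A B U : Set (Fin 3 →₀ ℕ)}
    (h : ∀ (a b : Fin 3 →₀ ℕ) (i j k : Fin 3), a + Finsupp.single j 1 ∈ A →
      b + Finsupp.single k 1 ∈ B → Finsupp.single i 1 + (a + b) ∈ U)
    {f g : MvPolynomial (Fin 3) ℝ} (hf : f ∈ restrictSupport ℝ A)
    (hg : g ∈ restrictSupport ℝ B) : polyBracket f g ∈ restrictSupport ℝ U := by
  have hd : ∀ (D : Set (Fin 3 →₀ ℕ)) (q : MvPolynomial (Fin 3) ℝ) (j : Fin 3),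
      q ∈ restrictSupport ℝ D →
        pderiv j q ∈ restrictSupport ℝ {a | a + Finsupp.single j 1 ∈ D} := by
    intro D q j hq
    rw [mem_restrictSupport_iff] at hq ⊢
    intro m hm
    apply hq
    simp only [Finset.mem_coe, mem_support_iff, coeff_pderiv] at hm ⊢
    exact left_ne_zero_of_mul hm
  have key : ∀ i j k : Fin 3, X i * (pderiv j f * pderiv k g) ∈ restrictSupport ℝ U := by
    intro i j k
    have hX : (X i : MvPolynomial (Fin 3) ℝ) ∈ restrictSupport ℝ {Finsupp.single i 1} := by
      simp [X]
    have := Submodule.mul_mem_mul hX (Submodule.mul_mem_mul (hd A f j hf) (hd B g k hg))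
    rw [← restrictSupport_add, ← restrictSupport_add] at this
    refine restrictSupport_mono (R := ℝ) ?_ this
    intro m hm
    obtain ⟨x, hx, y, hy, rfl⟩ := Set.mem_add.mp hm
    obtain ⟨a, ha, b, hb, rfl⟩ := Set.mem_add.mp hy
    rw [Set.mem_singleton_iff.mp hx]
    exact h a b i j k ha hb
  simp only [polyBracket, mul_sub]
  exact add_mem (add_mem (sub_mem (key _ _ _) (key _ _ _)) (sub_mem (key _ _ _) (key _ _ _)))
    (sub_mem (key _ _ _) (key _ _ _))

/-- The subspace `𝒫ᵏ` of elements of degree at most `k`. -/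
def polyLE (s : ℝ) (k : ℕ) : Submodule ℝ (Poly s) :=
  (restrictTotalDegree (Fin 3) ℝ k).map (mk s).toLinearMap

theorem mem_polyLE_iff {s : ℝ} {k : ℕ} {p : Poly s} : p ∈ polyLE s k ↔ degree p ≤ k := by
  constructor
  · rintro ⟨f, hf, rfl⟩
    have h : degree (mk s f) ≤ f.totalDegree := Nat.sInf_le ⟨f, rfl, rfl⟩
    exact h.trans ((mem_restrictTotalDegree _ _ _).mp hf)
  · intro h
    have hne : {n | ∃ f : MvPolynomial (Fin 3) ℝ, mk s f = p ∧ f.totalDegree = n}.Nonempty := by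
      obtain ⟨f, hf⟩ := mk_surjective s p
      exact ⟨_, f, hf, rfl⟩
    obtain ⟨f, hf, hd⟩ := Nat.sInf_mem hne
    exact ⟨f, (mem_restrictTotalDegree _ _ _).mpr (hd.trans_le h), hf⟩

/-- The Poisson subalgebra `𝒫¹` of elements of degree at most one. -/
def polyOne (s : ℝ) : LieSubalgebra ℝ (Poly s) where
  toSubmodule := polyLE s 1
  lie_mem' := by
    rintro _ _ ⟨f, hf, rfl⟩ ⟨g, hg, rfl⟩
    refine ⟨polyBracket f g, polyBracket_mem_restrictSupport ?_ hf hg, rfl⟩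
    intro a b i j k ha hb
    change (a + Finsupp.single j 1).degree ≤ 1 at ha
    change (b + Finsupp.single k 1).degree ≤ 1 at hb
    change (Finsupp.single i 1 + (a + b)).degree ≤ 1
    simp only [map_add, Finsupp.degree_single] at ha hb ⊢
    omega

/-- The Poisson subalgebra `𝒪` of odd polynomials: the classes of the polynomials all of whose
terms are of odd degree. -/
def odd (s : ℝ) : LieSubalgebra ℝ (Poly s) where
  toSubmodule := (restrictSupport ℝ {m : Fin 3 →₀ ℕ | Odd m.degree}).map (mk s).toLinearMap
  lie_mem' := by
    rintro _ _ ⟨f, hf, rfl⟩ ⟨g, hg, rfl⟩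
    refine ⟨polyBracket f g, polyBracket_mem_restrictSupport ?_ hf hg, rfl⟩
    intro a b i j k ha hb
    simp only [Set.mem_ofPred_eq, map_add, Finsupp.degree_single, Nat.odd_iff] at ha hb ⊢
    omega

theorem lie_one (s : ℝ) (p : Poly s) : ⁅p, (1 : Poly s)⁆ = 0 := by
  obtain ⟨f, rfl⟩ := mk_surjective s p
  rw [← map_one (mk s), mk_lie_mk]
  simp [polyBracket]

/-- The Poisson subalgebra `𝒪 ⊕ ℝ`: odd polynomials plus constants. -/
def oddTilde (s : ℝ) : LieSubalgebra ℝ (Poly s) where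
  toSubmodule := (odd s).toSubmodule ⊔ Submodule.span ℝ {1}
  lie_mem' := by
    intro p q hp hq
    obtain ⟨a, ha, u, hu, rfl⟩ := Submodule.mem_sup.mp hp
    obtain ⟨b, hb, v, hv, rfl⟩ := Submodule.mem_sup.mp hq
    obtain ⟨c, rfl⟩ := Submodule.mem_span_singleton.mp hu
    obtain ⟨d, rfl⟩ := Submodule.mem_span_singleton.mp hv
    have h1 : ∀ x : Poly s, ⁅(1 : Poly s), x⁆ = 0 := fun x => by
      rw [← lie_skew, lie_one, neg_zero]
    simp only [add_lie, lie_add, smul_lie, lie_smul, lie_one, h1, smul_zero, add_zero]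
    exact Submodule.mem_sup_left ((odd s).lie_mem ha hb)

end

end SpinSphere

/-!
Complexify, and read a polynomial modulo the equation of the sphere as a sum of products `(S₁ ± i
S₂)ⁿ F(S₃)`, which are eigenvectors of the rotation `{S₃, ·}`. Eigenvectors for distinct eigenvalues
separate, so a Lie algebra that contains the affine functions and something else contains such a
product that is not affine. Bracketing with `S₁ ± i S₂` raises `n` and differentiates `F`, so some
power `(S₁ ± i S₂)ᵐ` with `m ≥ 2` appears, and by complex conjugation so does the opposite one. The
bracket of the two is proportional to `S₃ (s² - S₃²)ᵐ⁻¹`, which a Legendre operator lowers to `S₃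
(s² - S₃²)`, giving `S₃³`. Brackets with `S₃³` produce every odd power of `S₃`, and rotations spread
these over all monomials of odd degree.
-/

namespace SpinSphere

open MvPolynomial
open Polynomial (derivative)

noncomputable section

section Eigenvectors

variable {K V ι : Type*} [Field K] [AddCommGroup V] [Module K V]

theorem mem_of_sum_mem_of_eigenvectors {T : Module.End K V} {W : Submodule K V}
    (hT : W ≤ W.comap T) {μ : ι → K} (hμ : Function.Injective μ) {v : ι → V}
    (hv : ∀ i, T (v i) = μ i • v i) {t : Finset ι} (h : ∑ i ∈ t, v i ∈ W) :
    ∀ i ∈ t, v i ∈ W := by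
  let T' : Module.End K (V ⧸ W) := W.mapQ W T hT
  have hind := T'.eigenspaces_iSupIndep.comp hμ
  have hmem (i : ι) : W.mkQ (v i) ∈ T'.eigenspace (μ i) := by
    rw [Module.End.mem_eigenspace_iff, Submodule.mkQ_apply, Submodule.mapQ_apply, hv,
      Submodule.Quotient.mk_smul]
  have hsum : ∑ i ∈ t, W.mkQ (v i) = 0 := by
    rwa [← map_sum, ← LinearMap.mem_ker, Submodule.ker_mkQ]
  intro i hi
  rw [← W.ker_mkQ, LinearMap.mem_ker]
  exact (iSupIndep_iff_finsetSum_eq_zero_imp_eq_zero _).mp hind t _ (fun i _ => hmem i) hsum i hi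

end Eigenvectors

section Rotation

variable {K A : Type*} [Field K] [CharZero K] [CommRing A] [Algebra K A]

theorem mul_pow_mul_pow_mem_of_rotation {D : Derivation K A A} {W : Submodule K A}
    (hW : ∀ f ∈ W, D f ∈ W) {w x y : A} (hw : D w = 0) (hx : D x = -y) (hy : D y = x) {n : ℕ}
    (hn : w * y ^ n ∈ W) (a b : ℕ) (hab : a + b = n) : w * (x ^ a * y ^ b) ∈ W := by
  induction a using Nat.strong_induction_on generalizing b with
  | _ a ih =>
    match a with
    | 0 => simpa [← hab] using hn
    | a + 1 =>
      have hD := hW _ (ih a a.lt_succ_self (b + 1) (by omega))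
      have hlow : (a : K) • (w * (x ^ (a - 1) * y ^ (b + 2))) ∈ W := by
        rcases a with _ | a
        · simp
        · exact W.smul_mem _ (ih a (by omega) (b + 2) (by omega))
      have hb : (b + 1 : K) ≠ 0 := by exact_mod_cast b.succ_ne_zero
      refine (W.smul_mem_iff hb).mp ?_
      convert W.add_mem hD hlow using 1
      simp only [Derivation.leibniz, Derivation.leibniz_pow, hw, hx, hy, smul_eq_mul,
        nsmul_eq_mul, Nat.add_sub_cancel]
      simp only [Algebra.smul_def, map_add, map_natCast, map_one]
      push_cast
      ring

end Rotation

/-! ### The bracket over an arbitrary ring -/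

section Bracket

variable {R S : Type*} [CommRing R] [CommRing S]

/-- The Hamiltonian derivation `{f, ·}` of `R[S₁, S₂, S₃]`; for `R = ℝ` it is `polyBracket f`. -/
def poisson (f : MvPolynomial (Fin 3) R) :
    Derivation R (MvPolynomial (Fin 3) R) (MvPolynomial (Fin 3) R) :=
  (X 1 * pderiv 2 f - X 2 * pderiv 1 f) • pderiv 0 +
    (X 2 * pderiv 0 f - X 0 * pderiv 2 f) • pderiv 1 +
    (X 0 * pderiv 1 f - X 1 * pderiv 0 f) • pderiv 2

theorem poisson_apply (f g : MvPolynomial (Fin 3) R) :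
    poisson f g =
      X 0 * (pderiv 1 f * pderiv 2 g - pderiv 2 f * pderiv 1 g) +
      X 1 * (pderiv 2 f * pderiv 0 g - pderiv 0 f * pderiv 2 g) +
      X 2 * (pderiv 0 f * pderiv 1 g - pderiv 1 f * pderiv 0 g) := by
  simp only [poisson, Derivation.add_apply, Derivation.smul_apply, smul_eq_mul]
  ring

theorem poisson_eq_polyBracket (f g : MvPolynomial (Fin 3) ℝ) :
    poisson f g = polyBracket f g :=
  poisson_apply f g

theorem poisson_antisymm (f g : MvPolynomial (Fin 3) R) : poisson f g = -poisson g f := by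
  rw [poisson_apply, poisson_apply]
  ring

theorem poisson_self (f : MvPolynomial (Fin 3) R) : poisson f f = 0 := by
  rw [poisson_apply]
  ring

theorem map_poisson (φ : R →+* S) (f g : MvPolynomial (Fin 3) R) :
    map φ (poisson f g) = poisson (map φ f) (map φ g) := by
  simp only [poisson_apply, pderiv_map, map_add, map_sub, map_mul, map_X]

theorem poisson_X_succ (i : Fin 3) :
    poisson (X i : MvPolynomial (Fin 3) R) (X (i + 1)) = X (i + 2) := by
  fin_cases i <;> simp [poisson_apply, pderiv_X]

theorem poisson_succ_X (i : Fin 3) :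
    poisson (X (i + 1) : MvPolynomial (Fin 3) R) (X i) = -X (i + 2) := by
  rw [poisson_antisymm, poisson_X_succ]

end Bracket

/-! ### Ladder and zonal polynomials -/

section Ladder

variable {R S : Type*} [CommRing R] [CommRing S] {c ε : R}

/-- For `ε² = -1` this is the ladder coordinate `S₁ + ε S₂`, an eigenvector of `{S₃, ·}`. -/
def ladder (ε : R) : MvPolynomial (Fin 3) R := X 0 + C ε * X 1

/-- The polynomial `F(S₃)`, invariant under rotations about the third axis. -/
def zonal : Polynomial R →ₐ[R] MvPolynomial (Fin 3) R := Polynomial.aeval (X 2)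

/-- The equation `S₁² + S₂² + S₃² - c` of the sphere with squared radius `c`. -/
def sphere (c : R) : MvPolynomial (Fin 3) R := X 0 ^ 2 + X 1 ^ 2 + X 2 ^ 2 - C c

/-- The polynomial `c - z²` giving `S₁² + S₂²` on the sphere in terms of the height `z = S₃`. -/
def profile (c : R) : Polynomial R := Polynomial.C c - Polynomial.X ^ 2

theorem map_ladder (φ : R →+* S) : map φ (ladder ε) = ladder (φ ε) := by
  simp [ladder]

theorem map_sphere (φ : R →+* S) : map φ (sphere c) = sphere (φ c) := by
  simp [sphere]

theorem zonal_X : zonal (Polynomial.X : Polynomial R) = X 2 :=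
  Polynomial.aeval_X _

theorem zonal_C (a : R) : zonal (Polynomial.C a) = C a :=
  Polynomial.aeval_C _ a

theorem poisson_zonal (f : MvPolynomial (Fin 3) R) (F : Polynomial R) :
    poisson f (zonal F) = zonal (derivative F) * poisson f (X 2) := by
  rw [zonal, Derivation.map_aeval, smul_eq_mul]

theorem poisson_X_two_zonal (F : Polynomial R) : poisson (X 2) (zonal F) = 0 := by
  rw [poisson_zonal, poisson_self, mul_zero]

theorem ne_zero_of_mul_self_eq_neg_one [Nontrivial R] (hε : ε * ε = -1) : ε ≠ 0 := by
  rintro rfl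
  simp at hε

theorem C_mul_C_eq_neg_one (hε : ε * ε = -1) :
    (C ε * C ε : MvPolynomial (Fin 3) R) = -1 := by
  rw [← C_mul, hε, C_neg, C_1]

theorem poisson_X_two_ladder (hε : ε * ε = -1) : poisson (X 2) (ladder ε) = -ε • ladder ε := by
  have h0 : poisson (X 2) (X 0 : MvPolynomial (Fin 3) R) = X 1 := poisson_X_succ 2
  have h1 : poisson (X 2) (X 1 : MvPolynomial (Fin 3) R) = -X 0 := poisson_succ_X 1
  rw [ladder, map_add, ← smul_eq_C_mul, Derivation.map_smul, h0, h1]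
  simp only [smul_eq_C_mul, C_neg]
  linear_combination X 1 * C_mul_C_eq_neg_one hε

theorem poisson_ladder_X_two (hε : ε * ε = -1) : poisson (ladder ε) (X 2) = ε • ladder ε := by
  rw [poisson_antisymm, poisson_X_two_ladder hε, neg_smul, neg_neg]

theorem poisson_ladder_neg_ladder (ε : R) :
    poisson (ladder (-ε)) (ladder ε) = (2 * ε) • X 2 := by
  have h01 : poisson (X 0) (X 1 : MvPolynomial (Fin 3) R) = X 2 := poisson_X_succ 0
  have h0 : poisson (X 0) (ladder (-ε)) = -ε • X 2 := by
    rw [ladder, map_add, ← smul_eq_C_mul, Derivation.map_smul, poisson_self, zero_add, h01]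
  have h1 : poisson (X 1) (ladder (-ε)) = -X 2 := by
    rw [ladder, map_add, ← smul_eq_C_mul, Derivation.map_smul, poisson_self, smul_zero, add_zero,
      poisson_antisymm, h01]
  rw [show ladder ε = X 0 + ε • X 1 by rw [ladder, smul_eq_C_mul], map_add, Derivation.map_smul,
    poisson_antisymm, h0, poisson_antisymm _ (X 1), h1]
  module

theorem ladder_mul_ladder_neg (hε : ε * ε = -1) (c : R) :
    ladder ε * ladder (-ε) = zonal (profile c) + sphere c := by
  simp only [ladder, profile, sphere, map_sub, map_pow, zonal_X, zonal_C, map_neg]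
  linear_combination -X 1 ^ 2 * C_mul_C_eq_neg_one hε

theorem derivative_profile (c : R) : derivative (profile c) = -2 * Polynomial.X := by
  rw [profile, Polynomial.derivative_sub, Polynomial.derivative_C, Polynomial.derivative_X_sq,
    map_ofNat]
  ring

theorem poisson_X_two_ladder_pow_mul_zonal (hε : ε * ε = -1) (n : ℕ) (F : Polynomial R) :
    poisson (X 2) (ladder ε ^ n * zonal F) = -(n * ε) • (ladder ε ^ n * zonal F) := by
  rw [Derivation.leibniz, Derivation.leibniz_pow, poisson_X_two_zonal, poisson_X_two_ladder hε]
  rcases n with _ | n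
  · simp
  · simp only [smul_eq_mul, nsmul_eq_mul, smul_eq_C_mul, Nat.add_sub_cancel, map_neg, map_mul,
      map_natCast]
    ring

theorem poisson_ladder_ladder_pow_mul_zonal (hε : ε * ε = -1) (n : ℕ) (F : Polynomial R) :
    poisson (ladder ε) (ladder ε ^ n * zonal F) =
      ε • (ladder ε ^ (n + 1) * zonal (derivative F)) := by
  rw [Derivation.leibniz, Derivation.leibniz_pow, poisson_zonal, poisson_self,
    poisson_ladder_X_two hε]
  simp only [smul_eq_mul, smul_eq_C_mul]
  ring

theorem poisson_ladder_mul_zonal_zonal (hε : ε * ε = -1) (F H : Polynomial R) :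
    poisson (ladder ε * zonal F) (zonal H) = ε • (ladder ε * zonal (F * derivative H)) := by
  rw [poisson_zonal, poisson_antisymm, Derivation.leibniz, poisson_X_two_zonal,
    poisson_X_two_ladder hε, map_mul]
  simp only [smul_eq_mul, smul_eq_C_mul, map_neg]
  ring

theorem poisson_ladder_neg_ladder_mul_zonal (hε : ε * ε = -1) (c : R) (F : Polynomial R) :
    poisson (ladder (-ε)) (ladder ε * zonal F) =
      -ε • (zonal (derivative (profile c * F)) + zonal (derivative F) * sphere c) := by
  rw [Derivation.leibniz, poisson_zonal, poisson_ladder_neg_ladder,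
    poisson_ladder_X_two (by rwa [neg_mul_neg]), Polynomial.derivative_mul, derivative_profile]
  simp only [smul_eq_mul, smul_eq_C_mul, map_add, map_mul, map_neg, map_ofNat, zonal_X]
  linear_combination -C ε * zonal (derivative F) * ladder_mul_ladder_neg hε c

theorem poisson_ladder_neg_pow_ladder_pow (ε : R) (m : ℕ) :
    poisson (ladder (-ε) ^ (m + 1)) (ladder ε ^ (m + 1)) =
      (2 * ε * (m + 1) ^ 2) • (X 2 * (ladder ε * ladder (-ε)) ^ m) := by
  rw [Derivation.leibniz_pow, poisson_antisymm, Derivation.leibniz_pow, poisson_antisymm,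
    poisson_ladder_neg_ladder]
  simp only [Nat.add_sub_cancel, smul_eq_mul, nsmul_eq_mul, smul_eq_C_mul, map_mul, map_add,
    map_pow, map_natCast, map_ofNat, map_one]
  push_cast
  ring

theorem derivative_X_mul_profile_pow (c : R) (k : ℕ) :
    derivative (Polynomial.X * profile c ^ (k + 1)) =
      (2 * (k : Polynomial R) + 3) * profile c ^ (k + 1) -
        2 * ((k : Polynomial R) + 1) * Polynomial.C c * profile c ^ k := by
  rw [Polynomial.derivative_mul, Polynomial.derivative_X, Polynomial.derivative_pow_succ,
    derivative_profile, profile]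
  simp only [map_add, map_natCast, map_one]
  ring

theorem derivative_profile_mul_derivative_X_mul_profile_pow (c : R) (k : ℕ) :
    derivative (profile c * derivative (Polynomial.X * profile c ^ (k + 1))) =
      (4 * (k + 1) ^ 2 * c) • (Polynomial.X * profile c ^ k) -
        (2 * (2 * k + 3) * (k + 2) : R) • (Polynomial.X * profile c ^ (k + 1)) := by
  have hpow (n : ℕ) : derivative (profile c ^ (n + 1)) =
      -2 * ((n : Polynomial R) + 1) * (Polynomial.X * profile c ^ n) := by
    rw [Polynomial.derivative_pow_succ, derivative_profile]
    simp only [map_add, map_natCast, map_one]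
    ring
  have hprod : profile c * derivative (Polynomial.X * profile c ^ (k + 1)) =
      Polynomial.C (2 * k + 3 : R) * profile c ^ (k + 1 + 1) -
        Polynomial.C (2 * (k + 1) * c) * profile c ^ (k + 1) := by
    rw [derivative_X_mul_profile_pow]
    simp only [map_add, map_mul, map_natCast, map_one, map_ofNat]
    ring
  rw [hprod, Polynomial.derivative_sub, Polynomial.derivative_C_mul, Polynomial.derivative_C_mul,
    hpow, hpow, Polynomial.smul_eq_C_mul, Polynomial.smul_eq_C_mul]
  simp only [map_add, map_mul, map_pow, map_natCast, map_one, map_ofNat]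
  push_cast
  ring

theorem derivative_profile_mul_derivative_X_cube_mul_derivative_X_pow (c : R) (k : ℕ) :
    derivative (profile c *
        (derivative (Polynomial.X ^ 3) * derivative (Polynomial.X ^ (2 * k + 1)))) =
      (6 * (2 * k + 1) * (k + 1) * c) • Polynomial.X ^ (2 * k + 1) -
        (6 * (2 * k + 1) * (k + 2) : R) • Polynomial.X ^ (2 * (k + 1) + 1) := by
  have hprod : profile c *
      (derivative (Polynomial.X ^ 3) * derivative (Polynomial.X ^ (2 * k + 1))) =
      Polynomial.C (3 * (2 * k + 1) * c) * Polynomial.X ^ (2 * k + 1 + 1) -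
        Polynomial.C (3 * (2 * k + 1) : R) * Polynomial.X ^ (2 * (k + 1) + 1 + 1) := by
    rw [Polynomial.derivative_X_pow_succ, Polynomial.derivative_X_pow_succ, profile]
    simp only [map_add, map_mul, map_natCast, map_one, map_ofNat]
    push_cast
    ring
  rw [hprod, Polynomial.derivative_sub, Polynomial.derivative_C_mul, Polynomial.derivative_C_mul,
    Polynomial.derivative_X_pow_succ, Polynomial.derivative_X_pow_succ,
    Polynomial.smul_eq_C_mul, Polynomial.smul_eq_C_mul]
  simp only [map_add, map_mul, map_natCast, map_one, map_ofNat]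
  push_cast
  ring

end Ladder
/-! ### Decomposition into weight vectors -/

section Weight

variable {R : Type*} [CommRing R] {c ε : R}

/-- The extremal vector `(S₁ + ε S₂)ᵏ` of weight `k`, or `(S₁ - ε S₂)⁻ᵏ` for negative `k`. -/
def weightVector (ε : R) : ℤ → MvPolynomial (Fin 3) R
  | Int.ofNat n => ladder ε ^ n
  | Int.negSucc n => ladder (-ε) ^ (n + 1)

theorem exists_weightVector_eq_ladder_pow (hε : ε * ε = -1) (k : ℤ) :
    ∃ δ : R, δ * δ = -1 ∧ ∃ n : ℕ, weightVector ε k = ladder δ ^ n ∧ (k : R) * ε = n * δ := by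
  rcases k with n | n
  · exact ⟨ε, hε, n, rfl, by simp⟩
  · exact ⟨-ε, by rwa [neg_mul_neg], n + 1, rfl, by push_cast [Int.cast_negSucc]; ring⟩

/-- The multiples of the `k`-th extremal vector by polynomials in `S₃`: the vectors of weight `k`,
up to multiples of the equation of the sphere. -/
def weightSpace (ε : R) (k : ℤ) : Submodule R (MvPolynomial (Fin 3) R) :=
  LinearMap.range (LinearMap.mulLeft R (weightVector ε k) ∘ₗ zonal.toLinearMap)

/-- The multiples of the equation of the sphere. -/
def sphereMultiples (c : R) : Submodule R (MvPolynomial (Fin 3) R) :=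
  LinearMap.range (LinearMap.mulRight R (sphere c))

theorem mul_sphere_mem_sphereMultiples (p : MvPolynomial (Fin 3) R) :
    p * sphere c ∈ sphereMultiples c :=
  ⟨p, rfl⟩

theorem weightVector_mul_zonal_mem_weightSpace (k : ℤ) (F : Polynomial R) :
    weightVector ε k * zonal F ∈ weightSpace ε k :=
  ⟨F, rfl⟩

theorem poisson_X_two_of_mem_weightSpace (hε : ε * ε = -1) {k : ℤ} {f : MvPolynomial (Fin 3) R}
    (hf : f ∈ weightSpace ε k) : poisson (X 2) f = -(k * ε) • f := by
  obtain ⟨F, rfl⟩ := hf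
  obtain ⟨δ, hδ, n, hk, hn⟩ := exists_weightVector_eq_ladder_pow hε k
  simp only [LinearMap.comp_apply, LinearMap.mulLeft_apply, AlgHom.toLinearMap_apply, hk, hn]
  exact poisson_X_two_ladder_pow_mul_zonal hδ n F

theorem ladder_pow_mul_zonal_mem_iSup_weightSpace (ε : R) (n : ℕ) (F : Polynomial R) :
    ladder ε ^ n * zonal F ∈ ⨆ k, weightSpace ε k :=
  Submodule.mem_iSup_of_mem (n : ℤ) (weightVector_mul_zonal_mem_weightSpace (n : ℤ) F)

theorem ladder_neg_pow_mul_zonal_mem_iSup_weightSpace (ε : R) (n : ℕ) (F : Polynomial R) :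
    ladder (-ε) ^ n * zonal F ∈ ⨆ k, weightSpace ε k := by
  rcases n with _ | n
  · simpa only [pow_zero] using ladder_pow_mul_zonal_mem_iSup_weightSpace ε 0 F
  · exact Submodule.mem_iSup_of_mem _
      (weightVector_mul_zonal_mem_weightSpace (Int.negSucc n) F)

theorem ladder_pow_mul_ladder_neg_pow_mul_zonal_mem (hε : ε * ε = -1) (c : R) (a b : ℕ)
    (F : Polynomial R) :
    ladder ε ^ a * ladder (-ε) ^ b * zonal F ∈ (⨆ k, weightSpace ε k) ⊔ sphereMultiples c := by
  induction a generalizing b F with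
  | zero =>
    rw [pow_zero, one_mul]
    exact Submodule.mem_sup_left (ladder_neg_pow_mul_zonal_mem_iSup_weightSpace ε b F)
  | succ a ih =>
    rcases b with _ | b
    · rw [pow_zero, mul_one]
      exact Submodule.mem_sup_left (ladder_pow_mul_zonal_mem_iSup_weightSpace ε (a + 1) F)
    · have hreduce : ladder ε ^ (a + 1) * ladder (-ε) ^ (b + 1) * zonal F =
          ladder ε ^ a * ladder (-ε) ^ b * zonal (profile c * F) +
            ladder ε ^ a * ladder (-ε) ^ b * zonal F * sphere c := by
        rw [map_mul]
        linear_combination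
          ladder ε ^ a * ladder (-ε) ^ b * zonal F * ladder_mul_ladder_neg hε c
      rw [hreduce]
      exact add_mem (ih b _) (Submodule.mem_sup_right (mul_sphere_mem_sphereMultiples _))

variable {K : Type*} [Field K] [NeZero (2 : K)] {ε : K}

theorem aeval_ladder_surjective (hε : ε * ε = -1) :
    Function.Surjective (aeval (R := K) ![ladder ε, ladder (-ε), X 2]) := by
  rw [← AlgHom.range_eq_top, ← Algebra.adjoin_range_eq_range_aeval, eq_top_iff, ← adjoin_range_X,
    Algebra.adjoin_le_iff]
  set B := Algebra.adjoin K (Set.range ![ladder ε, ladder (-ε), X 2])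
  have hmem (i : Fin 3) : ![ladder ε, ladder (-ε), X 2] i ∈ B :=
    Algebra.subset_adjoin (Set.mem_range_self i)
  have hε0 := ne_zero_of_mul_self_eq_neg_one hε
  have hX0 : (X 0 : MvPolynomial (Fin 3) K) = (2⁻¹ : K) • (ladder ε + ladder (-ε)) := by
    rw [eq_inv_smul_iff₀ two_ne_zero, two_smul, ladder, ladder, C_neg]
    ring
  have hX1 : (X 1 : MvPolynomial (Fin 3) K) = (2 * ε)⁻¹ • (ladder ε - ladder (-ε)) := by
    rw [eq_inv_smul_iff₀ (mul_ne_zero two_ne_zero hε0), mul_smul, two_smul, smul_eq_C_mul, ladder,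
      ladder, C_neg]
    ring
  rintro _ ⟨i, rfl⟩
  fin_cases i
  · exact hX0 ▸ B.smul_mem (B.add_mem (hmem 0) (hmem 1)) _
  · exact hX1 ▸ B.smul_mem (B.sub_mem (hmem 0) (hmem 1)) _
  · exact hmem 2

theorem iSup_weightSpace_sup_sphereMultiples (hε : ε * ε = -1) (c : K) :
    (⨆ k, weightSpace ε k) ⊔ sphereMultiples c = ⊤ := by
  refine eq_top_iff.mpr fun p _ => ?_
  obtain ⟨q, rfl⟩ := aeval_ladder_surjective hε p
  rw [q.as_sum, map_sum]
  refine Submodule.sum_mem _ fun m _ => ?_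
  have hmonomial : aeval ![ladder ε, ladder (-ε), X 2] (monomial m (coeff m q)) =
      ladder ε ^ m 0 * ladder (-ε) ^ m 1 *
        zonal (Polynomial.C (coeff m q) * Polynomial.X ^ m 2) := by
    rw [aeval_monomial, Finsupp.prod_fintype _ _ (by simp), Fin.prod_univ_three, map_mul, map_pow,
      zonal_C, zonal_X, algebraMap_eq]
    simp only [Matrix.cons_val_zero, Matrix.cons_val_one, Matrix.cons_val]
    ring
  exact hmonomial ▸ ladder_pow_mul_ladder_neg_pow_mul_zonal_mem hε c _ _ _

end Weight

/-- A Lie algebra of polynomials containing the coordinates and all multiples of the equation of the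
sphere of squared radius `c`, that is, the preimage of a Lie algebra containing the coordinates in
the quotient by that equation. -/
structure IsSphereAlgebra {R : Type*} [CommRing R] (c : R)
    (W : Submodule R (MvPolynomial (Fin 3) R)) : Prop where
  sphereMultiples_le : sphereMultiples c ≤ W
  X_mem : ∀ i, X i ∈ W
  poisson_mem : ∀ f ∈ W, ∀ g ∈ W, poisson f g ∈ W

namespace IsSphereAlgebra

section CommRing

variable {R : Type*} [CommRing R] {c ε : R} {W L : Submodule R (MvPolynomial (Fin 3) R)}

theorem mul_sphere_mem (hW : IsSphereAlgebra c W) (p : MvPolynomial (Fin 3) R) :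
    p * sphere c ∈ W :=
  hW.sphereMultiples_le (mul_sphere_mem_sphereMultiples p)

theorem ladder_mem (hW : IsSphereAlgebra c W) (ε : R) : ladder ε ∈ W := by
  rw [ladder, ← smul_eq_C_mul]
  exact W.add_mem (hW.X_mem 0) (W.smul_mem _ (hW.X_mem 1))

theorem ladder_pow_mul_zonal_mem_of_le_one (hL : IsSphereAlgebra c L) (h1 : 1 ∈ L) {n : ℕ}
    {F : Polynomial R} (h : n + F.natDegree ≤ 1) : ladder ε ^ n * zonal F ∈ L := by
  rcases n with _ | n
  · obtain ⟨a, b, rfl⟩ := Polynomial.exists_eq_X_add_C_of_natDegree_le_one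
      ((Nat.le_add_left _ 0).trans h)
    rw [pow_zero, one_mul, map_add, map_mul, zonal_C, zonal_C, zonal_X, ← mul_one (C b),
      ← smul_eq_C_mul, ← smul_eq_C_mul]
    exact L.add_mem (L.smul_mem a (hL.X_mem 2)) (L.smul_mem b h1)
  · obtain ⟨rfl, hF⟩ : n = 0 ∧ F.natDegree = 0 := by omega
    obtain ⟨a, rfl⟩ := Polynomial.natDegree_eq_zero.mp hF
    rw [zero_add, pow_one, zonal_C, mul_comm, ← smul_eq_C_mul]
    exact L.smul_mem a (hL.ladder_mem ε)

end CommRing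

section Field

variable {K : Type*} [Field K] {c ε : K} {W L : Submodule K (MvPolynomial (Fin 3) K)}

theorem zonal_derivative_profile_mul_mem (hW : IsSphereAlgebra c W) (hε : ε * ε = -1)
    {F H : Polynomial K} (hF : zonal F ∈ W) (hH : zonal H ∈ W) :
    zonal (derivative (profile c * (derivative F * derivative H))) ∈ W := by
  have hε0 := ne_zero_of_mul_self_eq_neg_one hε
  have hladder : ladder ε * zonal (derivative F) ∈ W := by
    have := hW.poisson_mem (ladder ε * zonal 1) (by simpa using hW.ladder_mem ε) _ hF
    rwa [poisson_ladder_mul_zonal_zonal hε, one_mul, W.smul_mem_iff hε0] at this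
  have hprod : ladder ε * zonal (derivative F * derivative H) ∈ W := by
    have := hW.poisson_mem _ hladder _ hH
    rwa [poisson_ladder_mul_zonal_zonal hε, W.smul_mem_iff hε0] at this
  have := hW.poisson_mem _ (hW.ladder_mem (-ε)) _ hprod
  rwa [poisson_ladder_neg_ladder_mul_zonal hε c, W.smul_mem_iff (neg_ne_zero.mpr hε0),
    W.add_mem_iff_left (hW.mul_sphere_mem _)] at this

variable [CharZero K]

theorem exists_ladder_pow_mul_zonal_mem_notMem (hW : IsSphereAlgebra c W) (hε : ε * ε = -1)
    (hL : sphereMultiples c ≤ L) (hWL : ¬W ≤ L) :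
    ∃ δ : K, δ * δ = -1 ∧ ∃ (n : ℕ) (F : Polynomial K),
      ladder δ ^ n * zonal F ∈ W ∧ ladder δ ^ n * zonal F ∉ L := by
  obtain ⟨f, hfW, hfL⟩ := SetLike.not_le_iff_exists.mp hWL
  have hf : f ∈ (⨆ k, weightSpace ε k) ⊔ sphereMultiples c := by
    rw [iSup_weightSpace_sup_sphereMultiples hε]
    exact Submodule.mem_top
  obtain ⟨g, hg, j, hj, rfl⟩ := Submodule.mem_sup.mp hf
  obtain ⟨v, hv, rfl⟩ := (Submodule.mem_iSup_iff_exists_finsupp _ _).mp hg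
  have hε0 := ne_zero_of_mul_self_eq_neg_one hε
  have hμ : Function.Injective fun k : ℤ => -((k : K) * ε) := fun a b h =>
    Int.cast_injective (mul_right_cancel₀ hε0 (neg_injective h))
  have hvW : ∀ k ∈ v.support, v k ∈ W :=
    mem_of_sum_mem_of_eigenvectors (T := (poisson (X 2)).toLinearMap)
      (fun f hf => hW.poisson_mem _ (hW.X_mem 2) f hf) hμ
      (fun k => poisson_X_two_of_mem_weightSpace hε (hv k))
      ((W.add_mem_iff_left (hW.sphereMultiples_le hj)).mp hfW)
  obtain ⟨k, hk, hkL⟩ : ∃ k ∈ v.support, v k ∉ L := by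
    by_contra! h
    exact hfL (L.add_mem (L.sum_mem h) (hL hj))
  obtain ⟨F, hF⟩ := hv k
  obtain ⟨δ, hδ, n, hn, -⟩ := exists_weightVector_eq_ladder_pow hε k
  have hvk : ladder δ ^ n * zonal F = v k := hn ▸ hF
  exact ⟨δ, hδ, n, F, hvk ▸ hvW k hk, hvk ▸ hkL⟩

theorem ladder_pow_mem (hW : IsSphereAlgebra c W) (hε : ε * ε = -1) {n : ℕ} {F : Polynomial K}
    (hF : F ≠ 0) (h : ladder ε ^ n * zonal F ∈ W) : ladder ε ^ (n + F.natDegree) ∈ W := by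
  have hε0 := ne_zero_of_mul_self_eq_neg_one hε
  induction hd : F.natDegree generalizing n F with
  | zero =>
    obtain ⟨a, rfl⟩ := Polynomial.natDegree_eq_zero.mp hd
    rwa [zonal_C, mul_comm, ← smul_eq_C_mul, W.smul_mem_iff (Polynomial.C_ne_zero.mp hF)] at h
  | succ d ih =>
    have hbracket := hW.poisson_mem _ (hW.ladder_mem ε) _ h
    rw [poisson_ladder_ladder_pow_mul_zonal hε, W.smul_mem_iff hε0] at hbracket
    have hF' : derivative F ≠ 0 := fun h0 => by
      rw [Polynomial.derivative_eq_zero] at h0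
      omega
    have hd' : (derivative F).natDegree = d := by
      rw [Polynomial.natDegree_derivative, hd, Nat.add_sub_cancel]
    have := ih hF' hbracket hd'
    rwa [add_right_comm] at this

theorem exists_ladder_pow_mem (hW : IsSphereAlgebra c W) (hε : ε * ε = -1)
    (hL : IsSphereAlgebra c L) (h1 : 1 ∈ L) (hWL : ¬W ≤ L) :
    ∃ δ : K, δ * δ = -1 ∧ ∃ m : ℕ, ladder δ ^ (m + 2) ∈ W := by
  obtain ⟨δ, hδ, n, F, hFW, hFL⟩ :=
    hW.exists_ladder_pow_mul_zonal_mem_notMem hε hL.sphereMultiples_le hWL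
  have hF : F ≠ 0 := by
    rintro rfl
    exact hFL (by simp)
  have hdeg : 2 ≤ n + F.natDegree := by
    by_contra! hlt
    exact hFL (hL.ladder_pow_mul_zonal_mem_of_le_one h1 (Nat.lt_succ_iff.mp hlt))
  obtain ⟨m, hm⟩ := Nat.exists_eq_add_of_le' hdeg
  exact ⟨δ, hδ, m, hm ▸ hW.ladder_pow_mem hδ hF hFW⟩

theorem zonal_X_mul_profile_pow_mem_of_ladder_pow_mem (hW : IsSphereAlgebra c W)
    (hε : ε * ε = -1) {m : ℕ} (hpos : ladder ε ^ (m + 1) ∈ W)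
    (hneg : ladder (-ε) ^ (m + 1) ∈ W) : zonal (Polynomial.X * profile c ^ m) ∈ W := by
  have hε0 := ne_zero_of_mul_self_eq_neg_one hε
  have hm : (2 * ε * (m + 1) ^ 2 : K) ≠ 0 :=
    mul_ne_zero (mul_ne_zero two_ne_zero hε0) (pow_ne_zero 2 (Nat.cast_add_one_ne_zero m))
  have hbracket := hW.poisson_mem _ hneg _ hpos
  rw [poisson_ladder_neg_pow_ladder_pow, W.smul_mem_iff hm, ladder_mul_ladder_neg hε c] at hbracket
  obtain ⟨p, hp⟩ := sub_dvd_pow_sub_pow (zonal (profile c) + sphere c) (zonal (profile c)) m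
  have hreduce : zonal (Polynomial.X * profile c ^ m) =
      X 2 * (zonal (profile c) + sphere c) ^ m - X 2 * p * sphere c := by
    rw [map_mul, map_pow, zonal_X]
    linear_combination -X 2 * hp
  exact hreduce ▸ W.sub_mem hbracket (hW.mul_sphere_mem _)

theorem zonal_X_mul_profile_pow_mem (hW : IsSphereAlgebra c W) (hε : ε * ε = -1) (hc : c ≠ 0)
    {k : ℕ} (h : zonal (Polynomial.X * profile c ^ (k + 1)) ∈ W) :
    zonal (Polynomial.X * profile c ^ k) ∈ W := by
  have hne : (4 * (k + 1) ^ 2 * c : K) ≠ 0 :=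
    mul_ne_zero (mul_ne_zero (by norm_num) (pow_ne_zero 2 (Nat.cast_add_one_ne_zero k))) hc
  have hlie := hW.zonal_derivative_profile_mul_mem hε h (H := Polynomial.X)
    (by simpa only [zonal_X] using hW.X_mem 2)
  rwa [Polynomial.derivative_X, mul_one, derivative_profile_mul_derivative_X_mul_profile_pow,
    map_sub, map_smul, map_smul, W.sub_mem_iff_left (W.smul_mem _ h), W.smul_mem_iff hne] at hlie

theorem zonal_X_cube_mem (hW : IsSphereAlgebra c W) (hε : ε * ε = -1) (hc : c ≠ 0) {m : ℕ}
    (hpos : ladder ε ^ (m + 2) ∈ W) (hneg : ladder (-ε) ^ (m + 2) ∈ W) :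
    zonal (Polynomial.X ^ 3) ∈ W := by
  have hprofile : zonal (Polynomial.X * profile c ^ (0 + 1)) ∈ W :=
    Nat.decreasingInduction (motive := fun k _ => zonal (Polynomial.X * profile c ^ (k + 1)) ∈ W)
      (fun _ _ => hW.zonal_X_mul_profile_pow_mem hε hc)
      (hW.zonal_X_mul_profile_pow_mem_of_ladder_pow_mem hε hpos hneg) m.zero_le
  have hcube : zonal (Polynomial.X ^ 3) = c • X 2 - zonal (Polynomial.X * profile c ^ (0 + 1)) := by
    rw [← zonal_X, ← map_smul, ← map_sub, profile, Polynomial.smul_eq_C_mul]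
    congr 1
    ring
  exact hcube ▸ W.sub_mem (W.smul_mem c (hW.X_mem 2)) hprofile

theorem zonal_X_pow_mem (hW : IsSphereAlgebra c W) (hε : ε * ε = -1)
    (hcube : zonal (Polynomial.X ^ 3) ∈ W) (k : ℕ) : zonal (Polynomial.X ^ (2 * k + 1)) ∈ W := by
  induction k with
  | zero => simpa [zonal_X] using hW.X_mem 2
  | succ k ih =>
    have hne : (6 * (2 * k + 1) * (k + 2) : K) ≠ 0 := by norm_cast
    have hlie := hW.zonal_derivative_profile_mul_mem hε hcube ih
    rwa [derivative_profile_mul_derivative_X_cube_mul_derivative_X_pow, map_sub, map_smul,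
      map_smul, W.sub_mem_iff_right (W.smul_mem _ ih), W.smul_mem_iff hne] at hlie

theorem mul_X_pow_mul_X_pow_mem (hW : IsSphereAlgebra c W) (i : Fin 3)
    {w : MvPolynomial (Fin 3) K} (hw : poisson (X i) w = 0) {n : ℕ} (h : w * X (i + 1) ^ n ∈ W)
    (a b : ℕ) (hab : a + b = n) : w * (X (i + 2) ^ a * X (i + 1) ^ b) ∈ W := by
  have hX : poisson (X i) (X (i + 2) : MvPolynomial (Fin 3) K) = -X (i + 1) := by
    simpa only [add_assoc, Fin.reduceAdd, add_zero] using poisson_succ_X (R := K) (i + 2)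
  exact mul_pow_mul_pow_mem_of_rotation (hW.poisson_mem _ (hW.X_mem i)) hw hX
    (poisson_X_succ i) h a b hab

theorem X_pow_mul_X_pow_mul_X_pow_mem (hW : IsSphereAlgebra c W) (i j k : ℕ)
    (h : X 2 ^ (i + j + k) ∈ W) : X 0 ^ i * X 1 ^ j * X 2 ^ k ∈ W := by
  have hmeridian : X 2 ^ k * X 0 ^ (i + j) ∈ W := by
    have := hW.mul_X_pow_mul_X_pow_mem 1 (w := 1) (Derivation.map_one_eq_zero _)
      (by simpa using h) (i + j) k rfl
    rwa [one_mul, mul_comm] at this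
  have hcommute : poisson (X 2) (X 2 ^ k : MvPolynomial (Fin 3) K) = 0 := by
    rw [Derivation.leibniz_pow, poisson_self, smul_zero, smul_zero]
  have := hW.mul_X_pow_mul_X_pow_mem 2 hcommute hmeridian j i (add_comm j i)
  convert this using 1
  simp only [Fin.reduceAdd]
  ring

theorem restrictSupport_odd_le (hW : IsSphereAlgebra c W) (hε : ε * ε = -1) (hc : c ≠ 0) {m : ℕ}
    (hpos : ladder ε ^ (m + 2) ∈ W) (hneg : ladder (-ε) ^ (m + 2) ∈ W) :
    restrictSupport K {n : Fin 3 →₀ ℕ | Odd n.degree} ≤ W := by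
  rw [restrictSupport_eq_span, Submodule.span_le]
  rintro _ ⟨n, ⟨k, hk⟩, rfl⟩
  have hzonal := hW.zonal_X_pow_mem hε (hW.zonal_X_cube_mem hε hc hpos hneg) k
  rw [map_pow, zonal_X, ← hk, Finsupp.degree_eq_sum, Fin.sum_univ_three] at hzonal
  have hn := hW.X_pow_mul_X_pow_mul_X_pow_mem _ _ _ hzonal
  simpa [monomial_eq, Finsupp.prod_fintype, Fin.prod_univ_three] using hn

end Field

end IsSphereAlgebra

/-! ### Complexification -/

section Complexification

variable {σ : Type*} {U : Submodule ℝ (MvPolynomial σ ℝ)}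

/-- The inclusion of the real polynomials into the complex ones. -/
abbrev toComplex : MvPolynomial σ ℝ →+* MvPolynomial σ ℂ :=
  map Complex.ofRealHom

theorem toComplex_smul (r : ℝ) (g : MvPolynomial σ ℝ) :
    toComplex (r • g) = (r : ℂ) • toComplex g := by
  rw [smul_eq_C_mul, map_mul, map_C, Complex.ofRealHom_eq_coe, smul_eq_C_mul]

theorem eq_of_toComplex_add_I_smul_toComplex_eq {g g' h h' : MvPolynomial σ ℝ}
    (e : toComplex g + Complex.I • toComplex h = toComplex g' + Complex.I • toComplex h') :
    g = g' := by
  ext m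
  have hm := congrArg (fun f => (coeff m f).re) e
  simpa [coeff_map] using hm

theorem exists_toComplex_add_I_smul_toComplex_eq (f : MvPolynomial σ ℂ) :
    ∃ g h : MvPolynomial σ ℝ, toComplex g + Complex.I • toComplex h = f := by
  induction f using MvPolynomial.induction_on with
  | C a =>
    refine ⟨C a.re, C a.im, ?_⟩
    rw [map_C, map_C, smul_eq_C_mul, ← C_mul, ← C_add, mul_comm]
    exact congrArg C a.re_add_im
  | add p q hp hq =>
    obtain ⟨g, h, rfl⟩ := hp
    obtain ⟨g', h', rfl⟩ := hq
    exact ⟨g + g', h + h', by rw [map_add, map_add, smul_add, add_add_add_comm]⟩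
  | mul_X p i hp =>
    obtain ⟨g, h, rfl⟩ := hp
    exact ⟨g * X i, h * X i, by rw [map_mul, map_mul, map_X, add_mul, smul_mul_assoc]⟩

/-- The complexification of a space of real polynomials: the complex polynomials whose real and
imaginary parts belong to the space. -/
def complexify (U : Submodule ℝ (MvPolynomial σ ℝ)) : Submodule ℂ (MvPolynomial σ ℂ) where
  carrier := {f | ∃ g ∈ U, ∃ h ∈ U, toComplex g + Complex.I • toComplex h = f}
  zero_mem' := ⟨0, U.zero_mem, 0, U.zero_mem, by rw [map_zero, smul_zero, add_zero]⟩
  add_mem' := by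
    rintro _ _ ⟨g, hg, h, hh, rfl⟩ ⟨g', hg', h', hh', rfl⟩
    refine ⟨g + g', U.add_mem hg hg', h + h', U.add_mem hh hh', ?_⟩
    rw [map_add, map_add, smul_add, add_add_add_comm]
  smul_mem' := by
    rintro c _ ⟨g, hg, h, hh, rfl⟩
    refine ⟨c.re • g - c.im • h, U.sub_mem (U.smul_mem _ hg) (U.smul_mem _ hh),
      c.re • h + c.im • g, U.add_mem (U.smul_mem _ hh) (U.smul_mem _ hg), ?_⟩
    simp only [map_add, map_sub, toComplex_smul]
    match_scalars
    · linear_combination c.re_add_im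
    · linear_combination Complex.I * c.re_add_im - c.im * Complex.I_mul_I

theorem toComplex_mem_complexify {g : MvPolynomial σ ℝ} : toComplex g ∈ complexify U ↔ g ∈ U := by
  constructor
  · rintro ⟨g', hg', h', -, e⟩
    exact eq_of_toComplex_add_I_smul_toComplex_eq (h' := 0) (by simpa using e) ▸ hg'
  · exact fun hg => ⟨g, hg, 0, U.zero_mem, by rw [map_zero, smul_zero, add_zero]⟩

theorem mul_toComplex_mem_complexify {q : MvPolynomial σ ℝ} (hq : ∀ p, p * q ∈ U)
    (f : MvPolynomial σ ℂ) : f * toComplex q ∈ complexify U := by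
  obtain ⟨g, h, rfl⟩ := exists_toComplex_add_I_smul_toComplex_eq f
  exact ⟨g * q, hq g, h * q, hq h, by rw [map_mul, map_mul, add_mul, smul_mul_assoc]⟩

theorem map_conj_mem_complexify {f : MvPolynomial σ ℂ} (hf : f ∈ complexify U) :
    map (starRingEnd ℂ) f ∈ complexify U := by
  have hconj (g : MvPolynomial σ ℝ) : map (starRingEnd ℂ) (toComplex g) = toComplex g := by
    rw [map_map, show (starRingEnd ℂ).comp Complex.ofRealHom = Complex.ofRealHom from
      RingHom.ext Complex.conj_ofReal]
  obtain ⟨g, hg, h, hh, rfl⟩ := hf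
  refine ⟨g, hg, -h, U.neg_mem hh, ?_⟩
  rw [map_add, smul_eq_C_mul, smul_eq_C_mul, map_mul, map_C, hconj, hconj, Complex.conj_I, map_neg,
    C_neg, mul_neg, neg_mul]

theorem poisson_mem_complexify {U : Submodule ℝ (MvPolynomial (Fin 3) ℝ)}
    (hU : ∀ f ∈ U, ∀ g ∈ U, poisson f g ∈ U) {f g : MvPolynomial (Fin 3) ℂ}
    (hf : f ∈ complexify U) (hg : g ∈ complexify U) : poisson f g ∈ complexify U := by
  have hreal {a : MvPolynomial (Fin 3) ℝ} (ha : a ∈ U) {p : MvPolynomial (Fin 3) ℂ}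
      (hp : p ∈ complexify U) : poisson (toComplex a) p ∈ complexify U := by
    obtain ⟨b, hb, d, hd, rfl⟩ := hp
    rw [map_add, Derivation.map_smul, ← map_poisson, ← map_poisson]
    exact ⟨_, hU a ha b hb, _, hU a ha d hd, rfl⟩
  obtain ⟨a, ha, b, hb, rfl⟩ := hf
  rw [poisson_antisymm, map_add, Derivation.map_smul, poisson_antisymm g, poisson_antisymm g]
  exact neg_mem (add_mem (neg_mem (hreal ha hg)) (Submodule.smul_mem _ _ (neg_mem (hreal hb hg))))

end Complexification

/-! ### Affine functions on the sphere -/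

section Affine

variable {σ R : Type*} [CommSemiring R]

theorem restrictTotalDegree_one_le {M : Submodule R (MvPolynomial σ R)} (h1 : 1 ∈ M)
    (hX : ∀ i, X i ∈ M) : restrictTotalDegree σ R 1 ≤ M := by
  rw [restrictTotalDegree, restrictSupport_eq_span, Submodule.span_le]
  rintro _ ⟨m, hm, rfl⟩
  rcases Nat.le_one_iff_eq_zero_or_eq_one.mp (show m.degree ≤ 1 from hm) with h | h
  · rwa [(Finsupp.degree_eq_zero_iff m).mp h]
  · obtain ⟨i, rfl⟩ := (Finsupp.sum_eq_one_iff m).mp h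
    exact hX i

theorem eval_add_eval_eq_of_mem_restrictTotalDegree_one {f : MvPolynomial σ R}
    (hf : f ∈ restrictTotalDegree σ R 1) {v w v' w' : σ → R} (h : v + w = v' + w') :
    eval v f + eval w f = eval v' f + eval w' f := by
  let M : Submodule R (MvPolynomial σ R) := LinearMap.eqLocus
    ((aeval v).toLinearMap + (aeval w).toLinearMap)
    ((aeval v').toLinearMap + (aeval w').toLinearMap)
  have hM (g : MvPolynomial σ R) :
      g ∈ M ↔ eval v g + eval w g = eval v' g + eval w' g := by
    simp [M, LinearMap.mem_eqLocus, aeval_eq_eval]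
  refine (hM f).mp (restrictTotalDegree_one_le ?_ (fun i => ?_) hf)
  · simp only [hM, map_one]
  · simpa only [hM, eval_X, ← Pi.add_apply] using congrFun h i

end Affine

variable {s : ℝ} {R : LieSubalgebra ℝ (Poly s)}

theorem mk_mul_sphere (p : MvPolynomial (Fin 3) ℝ) : mk s (p * sphere (s ^ 2)) = 0 := by
  rw [← map_zero (mk s), mk_eq_mk_iff, sub_zero]
  exact Ideal.mul_mem_left _ _ (Ideal.mem_span_singleton_self _)

theorem eval_eq_of_mk_eq {f g : MvPolynomial (Fin 3) ℝ} (h : mk s f = mk s g) {v : Fin 3 → ℝ}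
    (hv : v 0 ^ 2 + v 1 ^ 2 + v 2 ^ 2 = s ^ 2) : eval v f = eval v g := by
  obtain ⟨a, ha⟩ := Ideal.mem_span_singleton'.mp (mk_eq_mk_iff.mp h)
  rw [← sub_eq_zero, ← map_sub, ← ha]
  simp [hv]

theorem one_mem_polyOne (s : ℝ) : 1 ∈ polyOne s :=
  ⟨1, (mem_restrictTotalDegree _ _ _).mpr (by simp), map_one (mk s)⟩

theorem mk_X_mem_polyOne (s : ℝ) (i : Fin 3) : mk s (X i) ∈ polyOne s :=
  ⟨X i, (mem_restrictTotalDegree _ _ _).mpr (by simp), rfl⟩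

theorem mk_monomial_mem_odd (s : ℝ) {m : Fin 3 →₀ ℕ} (hm : Odd m.degree) (r : ℝ) :
    mk s (monomial m r) ∈ odd s :=
  ⟨monomial m r, (monomial_mem_restrictSupport ℝ).mpr (Or.inl hm), rfl⟩

theorem odd_le_oddTilde (s : ℝ) : odd s ≤ oddTilde s :=
  fun _ hp => Submodule.mem_sup_left (S := (odd s).toSubmodule) hp

theorem oddTilde_le_iff : oddTilde s ≤ R ↔ odd s ≤ R ∧ 1 ∈ R := by
  change (odd s).toSubmodule ⊔ Submodule.span ℝ {1} ≤ R.toSubmodule ↔ _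
  rw [sup_le_iff, Submodule.span_singleton_le_iff_mem]
  rfl

theorem polyOne_le_oddTilde (s : ℝ) : polyOne s ≤ oddTilde s := by
  have hle : restrictTotalDegree (Fin 3) ℝ 1 ≤
      (oddTilde s).toSubmodule.comap (mk s).toLinearMap := by
    refine restrictTotalDegree_one_le ?_ fun i => ?_
    · simpa using (oddTilde_le_iff.mp le_rfl).2
    · exact odd_le_oddTilde s (mk_monomial_mem_odd s (by simp) 1)
  rintro _ ⟨f, hf, rfl⟩
  exact hle hf

theorem mk_X_mul_X_mul_X_mem_odd (s : ℝ) : mk s (X 0 * X 1 * X 2) ∈ odd s := by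
  rw [X, X, X, monomial_mul, monomial_mul]
  exact mk_monomial_mem_odd s (by simp only [map_add, Finsupp.degree_single]; decide) _

-- `x y z` takes opposite values on two rectangles with the same centre inscribed in the sphere.
theorem mk_X_mul_X_mul_X_notMem_polyOne (hs : s ≠ 0) : mk s (X 0 * X 1 * X 2) ∉ polyOne s := by
  rintro ⟨f, hf, h⟩
  have hsphere {v : Fin 3 → ℝ} (hv : v 0 ^ 2 + v 1 ^ 2 + v 2 ^ 2 = s ^ 2) :
      eval v f = v 0 * v 1 * v 2 := by
    simpa using eval_eq_of_mk_eq h hv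
  have hrect := eval_add_eval_eq_of_mem_restrictTotalDegree_one hf
    (v := ![s / 3, 2 * s / 3, 2 * s / 3]) (w := ![-s / 3, -2 * s / 3, 2 * s / 3])
    (v' := ![s / 3, -2 * s / 3, 2 * s / 3]) (w' := ![-s / 3, 2 * s / 3, 2 * s / 3])
    (by simp [add_comm])
  rw [hsphere, hsphere, hsphere, hsphere] at hrect
  · simp only [Matrix.cons_val_zero, Matrix.cons_val_one, Matrix.cons_val] at hrect
    apply pow_ne_zero 3 hs
    linarith
  all_goals
    simp only [Matrix.cons_val_zero, Matrix.cons_val_one, Matrix.cons_val]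
    ring

theorem polyOne_lt_oddTilde (hs : s ≠ 0) : polyOne s < oddTilde s :=
  lt_of_le_not_ge (polyOne_le_oddTilde s) fun h =>
    mk_X_mul_X_mul_X_notMem_polyOne hs (h (odd_le_oddTilde s (mk_X_mul_X_mul_X_mem_odd s)))

/-! ### Lie subalgebras containing the affine functions -/

/-- The complex polynomials whose real and imaginary parts represent elements of `R`. -/
def complexPreimage (R : LieSubalgebra ℝ (Poly s)) : Submodule ℂ (MvPolynomial (Fin 3) ℂ) :=
  complexify (R.toSubmodule.comap (mk s).toLinearMap)

theorem toComplex_mem_complexPreimage {f : MvPolynomial (Fin 3) ℝ} :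
    toComplex f ∈ complexPreimage R ↔ mk s f ∈ R :=
  toComplex_mem_complexify

theorem le_of_complexPreimage_le_complexPreimage {R' : LieSubalgebra ℝ (Poly s)}
    (h : complexPreimage R ≤ complexPreimage R') : R ≤ R' := by
  intro r hr
  obtain ⟨f, rfl⟩ := mk_surjective s r
  exact toComplex_mem_complexPreimage.mp (h (toComplex_mem_complexPreimage.mpr hr))

theorem isSphereAlgebra_complexPreimage (hR : polyOne s ≤ R) :
    IsSphereAlgebra ((s : ℂ) ^ 2) (complexPreimage R) where
  sphereMultiples_le := by
    rintro _ ⟨p, rfl⟩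
    have hsphere : toComplex (sphere (s ^ 2)) = sphere ((s : ℂ) ^ 2) := by
      rw [map_sphere, map_pow, Complex.ofRealHom_eq_coe]
    rw [LinearMap.mulRight_apply, ← hsphere]
    refine mul_toComplex_mem_complexify (fun q => ?_) p
    rw [Submodule.mem_comap, AlgHom.toLinearMap_apply, mk_mul_sphere]
    exact zero_mem _
  X_mem i := by
    have := toComplex_mem_complexPreimage.mpr (hR (mk_X_mem_polyOne s i))
    rwa [map_X] at this
  poisson_mem _ hf _ hg := poisson_mem_complexify
    (fun f hf g hg => (poisson_eq_polyBracket f g).symm ▸ R.lie_mem hf hg) hf hg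

theorem conj_eq_neg_of_mul_self_eq_neg_one {δ : ℂ} (hδ : δ * δ = -1) :
    starRingEnd ℂ δ = -δ := by
  rcases mul_self_eq_mul_self_iff.mp (hδ.trans Complex.I_mul_I.symm) with rfl | rfl
  · exact Complex.conj_I
  · rw [map_neg, Complex.conj_I]

theorem odd_le_of_not_le_polyOne (hs : s ≠ 0) (hR : polyOne s ≤ R) (hne : ¬R ≤ polyOne s) :
    odd s ≤ R := by
  have hW := isSphereAlgebra_complexPreimage hR
  have hone : 1 ∈ complexPreimage (polyOne s) := by
    simpa using toComplex_mem_complexPreimage.mpr (one_mem_polyOne s)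
  obtain ⟨δ, hδ, m, hpos⟩ := hW.exists_ladder_pow_mem Complex.I_mul_I
    (isSphereAlgebra_complexPreimage le_rfl) hone
    (mt le_of_complexPreimage_le_complexPreimage hne)
  have hneg : ladder (-δ) ^ (m + 2) ∈ complexPreimage R := by
    have := map_conj_mem_complexify hpos
    rwa [map_pow, map_ladder, conj_eq_neg_of_mul_self_eq_neg_one hδ] at this
  have hodd := hW.restrictSupport_odd_le hδ (pow_ne_zero 2 (Complex.ofReal_ne_zero.mpr hs))
    hpos hneg
  rintro _ ⟨g, hg, rfl⟩
  refine toComplex_mem_complexPreimage.mp (hodd ?_)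
  rw [mem_restrictSupport_iff]
  exact (Finset.coe_subset.mpr (support_map_subset _ g)).trans
    ((mem_restrictSupport_iff _).mp hg)

theorem oddTilde_le_of_not_le_polyOne (hs : s ≠ 0) (hR : polyOne s ≤ R) (hne : ¬R ≤ polyOne s) :
    oddTilde s ≤ R :=
  oddTilde_le_iff.mpr ⟨odd_le_of_not_le_polyOne hs hR hne, hR (one_mem_polyOne s)⟩

end

end SpinSphere

theorem proposition3 (s : ℝ) (hs : 0 < s) :
    (SpinSphere.polyOne s < SpinSphere.oddTilde s ∧
      ∀ R : LieSubalgebra ℝ (SpinSphere.Poly s),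
        SpinSphere.polyOne s ≤ R → R ≤ SpinSphere.oddTilde s →
          R = SpinSphere.polyOne s ∨ R = SpinSphere.oddTilde s) ∧
    (∀ r ∈ SpinSphere.odd s, 1 < SpinSphere.degree r →
      LieSubalgebra.lieSpan ℝ (SpinSphere.Poly s)
        ((SpinSphere.polyOne s : Set (SpinSphere.Poly s)) ∪ {r}) = SpinSphere.oddTilde s) := by
  refine ⟨⟨SpinSphere.polyOne_lt_oddTilde hs.ne', fun R hR hR' => ?_⟩, fun r hr hdeg => ?_⟩
  · by_cases h : R ≤ SpinSphere.polyOne s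
    · exact Or.inl (le_antisymm h hR)
    · exact Or.inr (le_antisymm hR' (SpinSphere.oddTilde_le_of_not_le_polyOne hs.ne' hR h))
  · obtain ⟨hspan, hrspan⟩ := Set.union_subset_iff.mp (LieSubalgebra.subset_lieSpan (R := ℝ)
      (s := (SpinSphere.polyOne s : Set (SpinSphere.Poly s)) ∪ {r}))
    refine le_antisymm (LieSubalgebra.lieSpan_le.mpr (Set.union_subset
      (SpinSphere.polyOne_le_oddTilde s) ?_)) ?_
    · exact Set.singleton_subset_iff.mpr (SpinSphere.odd_le_oddTilde s hr)
    · refine SpinSphere.oddTilde_le_of_not_le_polyOne hs.ne' hspan fun h => hdeg.not_ge ?_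
      exact SpinSphere.mem_polyLE_iff.mp (h (hrspan rfl))
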